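/- Let $G$ be a finite connected weighted multigraph (loops and multiple edges allowed, all edge weights positive) with vertex set $V$, $|V|=n>1$. Let $A=(a_{ij})$ be its weighted adjacency matrix, where $a_{ij}$ is the total weight of the edges joining $i$ and $j$, and let $\rho$ be the spectral radius of $A$. For $t>0$ let $r_{ij}(t)$ be the total weight of all walks from $i$ to $j$ in the graph $G(t)$ obtained from $G$ by multiplying all edge weights by $t$ (the weight of a walk is the product of the weights of its edges with repetition; the walk of length $0$ has weight $1$). When all $r_{ij}(t)$ are finite, put $$d_t(i,j)=\tfrac12\bigl(\ln r_{ii}(t)+\ln r_{jj}(t)\bigr)-\ln r_{ij}(t).$$ For $\alpha>0$ put $$d^{\mathrm W}_\alpha(i,j)=\theta\, d_t(i,j),\qquad t=(\rho+\alpha^{-1})^{-1},\qquad \theta=\ln\bigl(e+\alpha^{2/n}\bigr)\,\frac{\alpha-1}{\ln\alpha}$$ (with $\theta=\ln(e+1)$ for $\alpha=1$). The long walk distance is $d^{\mathrm{LW}}(i,j)=\lim_{\alpha\to\infty}d^{\mathrm W}_\alpha(i,j)$. Then, for every $\alpha>0$, all $r_{ij}(t)$ with $t=(\rho+\alpha^{-1})^{-1}$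 are finite; the limit $d^{\mathrm{LW}}(i,j)$ exists for all $i,j\in V$; $d^{\mathrm{LW}}$ is a metric on $V$; and 1. $d^{\mathrm{LW}}$ is graph-geodetic: for all $i,j,k\in V$, the equality $d^{\mathrm{LW}}(i,j)+d^{\mathrm{LW}}(j,k)=d^{\mathrm{LW}}(i,k)$ holds if and only if every path (walk with distinct vertices) in $G$ from $i$ to $k$ contains $j$; 2. $d^{\mathrm{LW}}$ is a squared Euclidean distance: there are $m\ge 0$ and points $x_i\in\mathbb R^m$ $(i\in V)$ such that $d^{\mathrm{LW}}(i,j)=\|x_i-x_j\|_2^2$ for all $i,j\in V$. -/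

import Mathlib

open Filter Topology

/-- A weighted multigraph with vertex set `V` and edge set `E`. Loops (`ends e = s(i, i)`) and
multiple edges are allowed, and every edge has a positive weight. -/
structure WeightedMultigraph (V : Type*) (E : Type*) where
  /-- the unordered pair of end vertices of an edge -/
  ends : E → Sym2 V
  /-- the weight of an edge -/
  weight : E → ℝ
  weight_pos : ∀ e, 0 < weight e

namespace WeightedMultigraph

universe u v

/-- A walk from `i` to `k`: an alternating sequence of vertices and edges in which every edge
joins the two vertices next to it. -/
inductive Walk {V : Type u} {E : Type v} (G : WeightedMultigraph V E) : V → V → Type (max u v)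
  | nil {i : V} : Walk G i i
  | cons {i j k : V} (e : E) (h : G.ends e = s(i, j)) (p : Walk G j k) : Walk G i k

namespace Walk

/-- The sequence of vertices of a walk. -/
def support {V : Type u} {E : Type v} {G : WeightedMultigraph V E} {i k : V} : G.Walk i k → List V
  | @nil _ _ _ i => [i]
  | @cons _ _ _ i _ _ _ _ p => i :: p.support

/-- A path is a walk all of whose vertices are distinct. -/
def IsPath {V : Type u} {E : Type v} {G : WeightedMultigraph V E} {i k : V} (p : G.Walk i k) :
    Prop :=
  p.support.Nodup

/-- The weight of a walk in the graph `G(t)` that is obtained from `G` by multiplying all edge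
weights by `t`: the product of the weights in `G(t)` of its edges (with repetition). -/
def weight {V : Type u} {E : Type v} {G : WeightedMultigraph V E} (t : ℝ) {i k : V} :
    G.Walk i k → ℝ
  | nil => 1
  | cons e _ p => (t * G.weight e) * p.weight t

end Walk

variable {V : Type u} {E : Type v}

/-- Every two vertices are joined by a walk. -/
def Connected (G : WeightedMultigraph V E) : Prop :=
  ∀ i j : V, Nonempty (G.Walk i j)

/-- `d` is graph-geodetic for `G`: `d(i,j) + d(j,k) = d(i,k)` if and only if every path in `G`
connecting `i` and `k` contains `j`. -/
def IsGraphGeodetic (G : WeightedMultigraph V E) (d : V → V → ℝ) : Prop :=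
  ∀ i j k : V, d i j + d j k = d i k ↔ ∀ p : G.Walk i k, p.IsPath → j ∈ p.support

/-- The matrix of walk weights of `G(t)` exists: the total weight of the `i → j` walks in `G(t)` is
finite for all `i` and `j`. -/
def WalkWeightsFinite (G : WeightedMultigraph V E) (t : ℝ) : Prop :=
  ∀ i j : V, Summable fun p : G.Walk i j => p.weight t

/-- `r_{ij}(t)`, the total weight of all `i → j` walks in `G(t)`. -/
noncomputable def walkWeight (G : WeightedMultigraph V E) (t : ℝ) (i j : V) : ℝ :=
  ∑' p : G.Walk i j, p.weight t

/-- `d_t(i,j) = (h_{ii}(t) + h_{jj}(t)) / 2 - h_{ij}(t)` with `h_{ij}(t) = ln r_{ij}(t)`. -/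
noncomputable def walkDist (G : WeightedMultigraph V E) (t : ℝ) (i j : V) : ℝ :=
  (Real.log (G.walkWeight t i i) + Real.log (G.walkWeight t j j)) / 2
    - Real.log (G.walkWeight t i j)

section Finite

variable [Fintype V] [DecidableEq V] [Fintype E]

/-- The weighted adjacency matrix: `a_{ij}` is the total weight of the edges with ends `i`, `j`. -/
def adjMatrix (G : WeightedMultigraph V E) : Matrix V V ℝ :=
  Matrix.of fun i j => ∑ e : E, if G.ends e = s(i, j) then G.weight e else 0

/-- The spectral radius of the weighted adjacency matrix (the largest modulus of its complex
eigenvalues). -/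
noncomputable def perronRoot (G : WeightedMultigraph V E) : ℝ :=
  (spectralRadius ℂ (G.adjMatrix.map Complex.ofReal)).toReal

/-- The parameter `t = (ρ + α⁻¹)⁻¹`, that is, `α = (t⁻¹ - ρ)⁻¹`. -/
noncomputable def tParam (G : WeightedMultigraph V E) (α : ℝ) : ℝ :=
  (G.perronRoot + α⁻¹)⁻¹

end Finite

/-- The scaling factor `θ = ln(e + α^{2/n}) (α - 1) / ln α`, extended to `α = 1` by continuity. -/
noncomputable def scalingFactor (n : ℕ) (α : ℝ) : ℝ :=
  if α = 1 then Real.log (Real.exp 1 + 1)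
  else Real.log (Real.exp 1 + α ^ (2 / (n : ℝ))) * ((α - 1) / Real.log α)

section Finite

variable [Fintype V] [DecidableEq V] [Fintype E]

/-- The scaled walk distance `d^W_α(i,j) = θ d_t(i,j)`. -/
noncomputable def scaledWalkDist (G : WeightedMultigraph V E) (α : ℝ) (i j : V) : ℝ :=
  scalingFactor (Fintype.card V) α * G.walkDist (G.tParam α) i j

/-- The long walk distance `d^{LW}(i,j)`, the limit of `d^W_α(i,j)` as `α → ∞`. -/
noncomputable def longWalkDist (G : WeightedMultigraph V E) (i j : V) : ℝ :=
  limUnder atTop fun α : ℝ => G.scaledWalkDist α i j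

end Finite

end WeightedMultigraph

/-- The axioms of a metric for a real function of two points. -/
structure IsDistance {V : Type*} (d : V → V → ℝ) : Prop where
  nonneg : ∀ i j, 0 ≤ d i j
  eq_zero_iff : ∀ i j, d i j = 0 ↔ i = j
  symm : ∀ i j, d i j = d j i
  triangle : ∀ i j k, d i k ≤ d i j + d j k

/-- `d` is a squared Euclidean distance: the points can be placed in a Euclidean space so that
`d(i,j)` is the square of the distance of the images of `i` and `j`. -/
def IsSquaredEuclidean {V : Type*} (d : V → V → ℝ) : Prop :=
  ∃ (m : ℕ) (x : V → EuclideanSpace ℝ (Fin m)), ∀ i j, d i j = dist (x i) (x j) ^ 2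

/-! With ε = α⁻¹, the matrix of walk weights is, up to the factor r + ε, the resolvent (rI - A +
εI)⁻¹, where r = ρ is the Perron root with positive unit eigenvector p. Splitting off the pole at ε
= 0 along ppᵀ gives r_ij = c p_i p_j (1 + ε(1 + ε) K_ε(i,j)) with c independent of i, j, where
K_ε(i,j) = ((rI - A + ppᵀ + εI)⁻¹)_ij / (p_i p_j) (`walkWeight_eq`). In d_t the logarithms of c and
p cancel, and θ ~ 2α/n compensates the remaining factor ε, so the limit is (K_ii + K_jj - 2K_ij)/n
with K = K_0 (`tendsto_scaledWalkDist`).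

This kernel is positive definite, which yields the Euclidean embedding. It is also electrical: for
conductances p_k a_kl p_l, the function u(l) = K_lk - K_lj is the potential of a unit current from k
to j (`sum_mul_potential`). The triangle defect d(i,j) + d(j,k) - d(i,k) is (2/n)(u(i) - u(j)). The
minimum principle makes it nonnegative, and zero exactly when j separates i from k (`potential_le`,
`potential_eq_iff`). -/

namespace WeightedMultigraph

open scoped ENNReal

universe u v

variable {V : Type u} {E : Type v} {G : WeightedMultigraph V E}

/-! ### Walks, truncated weights, and reduction of walks to paths. -/

namespace Walk

/-- A walk is either trivial or consists of a first edge and a remaining walk. -/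
def equivSum (G : WeightedMultigraph V E) (i k : V) :
    G.Walk i k ≃ PLift (i = k) ⊕ Σ x : {x : E × V // G.ends x.1 = s(i, x.2)}, G.Walk x.1.2 k where
  toFun
    | nil => Sum.inl ⟨rfl⟩
    | @cons _ _ _ _ j _ e h p => Sum.inr ⟨⟨(e, j), h⟩, p⟩
  invFun
    | Sum.inl ⟨h⟩ => h ▸ nil
    | Sum.inr ⟨x, p⟩ => cons x.1.1 x.2 p
  left_inv p := by cases p <;> rfl
  right_inv x := by
    rcases x with ⟨⟨rfl⟩⟩ | ⟨x, p⟩ <;> rfl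

/-- The weight of a walk if it has fewer than `N` edges, and `0` otherwise. -/
noncomputable def truncWeight (t : ℝ) : ℕ → {i k : V} → G.Walk i k → ℝ≥0∞
  | 0, _, _, _ => 0
  | _ + 1, _, _, nil => 1
  | N + 1, _, _, cons e _ p => ENNReal.ofReal (t * G.weight e) * truncWeight t N p

theorem weight_nonneg {t : ℝ} (ht : 0 ≤ t) {i k : V} (p : G.Walk i k) : 0 ≤ p.weight t := by
  induction p with
  | nil => simp [weight]
  | cons e h p ih => exact mul_nonneg (mul_nonneg ht (G.weight_pos e).le) ih

/-- Truncation has no effect once N exceeds the number of edges, so a bound on truncated sums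
uniform in N passes to the full sum. -/
theorem exists_truncWeight_eq {t : ℝ} (ht : 0 ≤ t) {i k : V} (p : G.Walk i k) :
    ∃ N₀, ∀ N ≥ N₀, p.truncWeight t N = ENNReal.ofReal (p.weight t) := by
  induction p with
  | nil =>
    refine ⟨1, fun N hN => ?_⟩
    obtain ⟨N, rfl⟩ := Nat.exists_eq_add_of_le' hN
    simp [truncWeight, weight]
  | cons e h p ih =>
    obtain ⟨N₀, h₀⟩ := ih
    refine ⟨N₀ + 1, fun N hN => ?_⟩
    obtain ⟨N, rfl⟩ := Nat.exists_eq_add_of_le' (show 1 ≤ N by omega)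
    rw [truncWeight, weight, h₀ N (by omega),
      ENNReal.ofReal_mul (mul_nonneg ht (G.weight_pos e).le)]

theorem end_mem_support {i k : V} (p : G.Walk i k) : k ∈ p.support := by
  induction p with
  | nil => simp [support]
  | cons e h p ih => simp [support, ih]

theorem IsPath.exists_of_mem_support {j k : V} {p : G.Walk j k} (hp : p.IsPath) {i : V}
    (hi : i ∈ p.support) : ∃ q : G.Walk i k, q.IsPath ∧ q.support ⊆ p.support := by
  induction p with
  | nil =>
    obtain rfl : i = _ := by simpa [support] using hi
    exact ⟨nil, hp, fun _ h => h⟩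
  | cons e h p ih =>
    by_cases hij : i ∈ p.support
    · obtain ⟨q, hq, hs⟩ := ih (List.Nodup.of_cons hp) hij
      exact ⟨q, hq, fun x hx => List.mem_cons_of_mem _ (hs hx)⟩
    · obtain rfl : i = _ := by simpa [support, hij] using hi
      exact ⟨cons e h p, hp, fun _ h => h⟩

/-- Loop erasure: if the new first vertex recurs in the path built so far, keep only the part from
that occurrence on. -/
theorem exists_isPath {i k : V} (p : G.Walk i k) :
    ∃ q : G.Walk i k, q.IsPath ∧ q.support ⊆ p.support := by
  induction p with
  | nil => exact ⟨nil, by simp [IsPath, support], fun _ h => h⟩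
  | @cons i j k e h p ih =>
    obtain ⟨q, hq, hs⟩ := ih
    by_cases hi : i ∈ q.support
    · obtain ⟨r, hr, hrs⟩ := hq.exists_of_mem_support hi
      exact ⟨r, hr, fun x hx => List.mem_cons_of_mem _ (hs (hrs hx))⟩
    · exact ⟨cons e h q, List.nodup_cons.2 ⟨hi, hq⟩, List.cons_subset_cons _ hs⟩

/-- Walks are easier than paths in the potential theory, since prepending an edge needs no
distinctness check. -/
theorem forall_isPath_mem_support_iff {i j k : V} :
    (∀ p : G.Walk i k, p.IsPath → j ∈ p.support) ↔ ∀ p : G.Walk i k, j ∈ p.support := by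
  refine ⟨fun H p => ?_, fun H p _ => H p⟩
  obtain ⟨q, hq, hs⟩ := p.exists_isPath
  exact hs (H q hq)

end Walk

/-! ### Total walk weights and their first-edge recursion. -/

variable [DecidableEq V] [Fintype E]

theorem adjMatrix_nonneg (G : WeightedMultigraph V E) (i j : V) : 0 ≤ G.adjMatrix i j :=
  Finset.sum_nonneg fun e _ => by split_ifs <;> simp [(G.weight_pos e).le]

theorem adjMatrix_comm (G : WeightedMultigraph V E) (i j : V) :
    G.adjMatrix i j = G.adjMatrix j i := by
  simp [adjMatrix, Sym2.eq_swap]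

theorem adjMatrix_pos {i j : V} {e : E} (h : G.ends e = s(i, j)) : 0 < G.adjMatrix i j := by
  refine Finset.sum_pos' (fun e _ => by split_ifs <;> simp [(G.weight_pos e).le])
    ⟨e, Finset.mem_univ _, ?_⟩
  simp [h, G.weight_pos]

theorem exists_ends_of_adjMatrix_ne_zero {i j : V} (h : G.adjMatrix i j ≠ 0) :
    ∃ e, G.ends e = s(i, j) := by
  obtain ⟨e, -, he⟩ := Finset.exists_ne_zero_of_sum_ne_zero h
  exact ⟨e, by by_contra hne; simp [hne] at he⟩

variable [Fintype V]

/-- Splitting off the first edge in a sum over all walks from `i` to `k`. -/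
theorem tsum_walk {t : ℝ} (ht : 0 ≤ t) (f g : ∀ {i k : V}, G.Walk i k → ℝ≥0∞)
    (hnil : ∀ i : V, f (Walk.nil : G.Walk i i) = 1)
    (hcons : ∀ {i j k : V} (e : E) (h : G.ends e = s(i, j)) (p : G.Walk j k),
      f (Walk.cons e h p) = ENNReal.ofReal (t * G.weight e) * g p) (i k : V) :
    ∑' p : G.Walk i k, f p = (if i = k then 1 else 0) +
      ∑ j, ENNReal.ofReal (t * G.adjMatrix i j) * ∑' p : G.Walk j k, g p := by
  rw [← (Walk.equivSum G i k).symm.tsum_eq, ENNReal.summable.tsum_sum ENNReal.summable]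
  congr 1
  · split_ifs with h
    · subst h
      have : Unique (PLift (i = i)) := ⟨⟨⟨rfl⟩⟩, fun _ => rfl⟩
      rw [tsum_fintype, Fintype.sum_unique]
      exact hnil i
    · have : IsEmpty (PLift (i = k)) := ⟨fun x => h x.down⟩
      simp
  · have h1 : ∀ x : Σ x : {x : E × V // G.ends x.1 = s(i, x.2)}, G.Walk x.1.2 k,
        f ((Walk.equivSum G i k).symm (Sum.inr x)) =
          ENNReal.ofReal (t * G.weight x.1.1.1) * g x.2 := fun x => hcons _ _ _
    simp_rw [h1]
    rw [ENNReal.tsum_sigma']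
    simp_rw [ENNReal.tsum_mul_left]
    rw [tsum_fintype]
    have h2 := Finset.sum_subtype_eq_sum_filter (s := (Finset.univ : Finset (E × V)))
      (p := fun x => G.ends x.1 = s(i, x.2))
      (fun x => ENNReal.ofReal (t * G.weight x.1) * ∑' p : G.Walk x.2 k, g p)
    have h3 : (Finset.univ : Finset (E × V)).subtype (fun x => G.ends x.1 = s(i, x.2)) =
        Finset.univ := by ext; simp
    rw [h3] at h2
    refine h2.trans ?_
    rw [Finset.sum_filter, Fintype.sum_prod_type_right]
    refine Finset.sum_congr rfl fun j _ => ?_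
    rw [adjMatrix, Matrix.of_apply, Finset.mul_sum, ENNReal.ofReal_sum_of_nonneg, Finset.sum_mul]
    · refine Finset.sum_congr rfl fun e _ => ?_
      split_ifs <;> simp
    · intro e _
      split_ifs <;> simp [mul_nonneg ht (G.weight_pos e).le]

/-- If `A` has a positive vector `p` with `t A p = s p`, `s < 1`, the walk weights of `G(t)` are
summable. -/
theorem tsum_ofReal_weight_lt_top {t s : ℝ} (ht : 0 ≤ t) (hs0 : 0 ≤ s) (hs : s < 1) {p : V → ℝ}
    (hp : ∀ i, 0 < p i) (hA : ∀ i, ∑ j, t * G.adjMatrix i j * p j = s * p i) (i k : V) :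
    ∑' q : G.Walk i k, ENNReal.ofReal (q.weight t) < ∞ := by
  have hs' : 0 < 1 - s := by linarith
  -- The bound is a supersolution of f = δ + tAf: the delta is at most p_i/p_k, and tA multiplies p
  -- by s, with 1 + s(1 - s)⁻¹ = (1 - s)⁻¹.
  have key : ∀ N i, ∑' q : G.Walk i k, q.truncWeight t N ≤
      ENNReal.ofReal ((1 - s)⁻¹ * p i / p k) := by
    intro N
    induction N with
    | zero => intro i; simp [Walk.truncWeight]
    | succ N ih =>
      intro i
      -- Removing the first edge lowers the truncation level by one, hence different functions for
      -- `f` and `g`.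
      rw [tsum_walk ht (fun q => q.truncWeight t (N + 1)) (fun q => q.truncWeight t N)
        (fun _ => rfl) (fun _ _ _ => rfl)]
      have h1 : (if i = k then 1 else 0 : ℝ≥0∞) ≤ ENNReal.ofReal (p i / p k) := by
        split_ifs with h
        · subst h; simp [(hp i).ne']
        · simp
      calc _ ≤ ENNReal.ofReal (p i / p k) + ∑ j, ENNReal.ofReal (t * G.adjMatrix i j) *
              ENNReal.ofReal ((1 - s)⁻¹ * p j / p k) := by
            gcongr with j
            exact ih j
        _ = ENNReal.ofReal (p i / p k) + ENNReal.ofReal (∑ j, t * G.adjMatrix i j *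
              ((1 - s)⁻¹ * p j / p k)) := by
            rw [ENNReal.ofReal_sum_of_nonneg]
            · congr 1
              refine Finset.sum_congr rfl fun j _ => ?_
              rw [ENNReal.ofReal_mul (mul_nonneg ht (G.adjMatrix_nonneg i j))]
            · intro j _
              have := hp j; have := hp k; have := G.adjMatrix_nonneg i j
              positivity
        _ = ENNReal.ofReal ((1 - s)⁻¹ * p i / p k) := by
            have h2 : ∑ j, t * G.adjMatrix i j * ((1 - s)⁻¹ * p j / p k) =
                (1 - s)⁻¹ / p k * (s * p i) := by
              rw [← hA, Finset.mul_sum]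
              exact Finset.sum_congr rfl fun j _ => by ring
            have := hp i; have := hp k
            rw [h2, ← ENNReal.ofReal_add (by positivity) (by positivity)]
            congr 1
            field_simp
            ring
  refine lt_of_le_of_lt ?_ (ENNReal.ofReal_lt_top (r := (1 - s)⁻¹ * p i / p k))
  rw [ENNReal.tsum_eq_iSup_sum]
  refine iSup_le fun F => ?_
  choose N hN using fun q : G.Walk i k => q.exists_truncWeight_eq ht
  calc ∑ q ∈ F, ENNReal.ofReal (q.weight t) = ∑ q ∈ F, q.truncWeight t (F.sup N) :=
        Finset.sum_congr rfl fun q hq => (hN q _ (Finset.le_sup hq)).symm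
    _ ≤ ∑' q : G.Walk i k, q.truncWeight t (F.sup N) := ENNReal.sum_le_tsum F
    _ ≤ _ := key _ i

theorem walkWeightsFinite_of_eigenvector {t s : ℝ} (ht : 0 ≤ t) (hs0 : 0 ≤ s) (hs : s < 1)
    {p : V → ℝ} (hp : ∀ i, 0 < p i) (hA : ∀ i, ∑ j, t * G.adjMatrix i j * p j = s * p i) :
    G.WalkWeightsFinite t := fun i k => by
  have h := ENNReal.summable_toReal (tsum_ofReal_weight_lt_top ht hs0 hs hp hA i k).ne
  exact h.congr fun q => ENNReal.toReal_ofReal (q.weight_nonneg ht)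

/-- First-edge decomposition in matrix form: the walk weights are a right inverse of I - tA,
obtained without a Neumann series. -/
theorem WalkWeightsFinite.walkWeight_eq {t : ℝ} (ht : 0 ≤ t) (h : G.WalkWeightsFinite t) :
    Matrix.of (G.walkWeight t) = 1 + (t • G.adjMatrix) * Matrix.of (G.walkWeight t) := by
  have h0 : ∀ i k, 0 ≤ G.walkWeight t i k := fun i k => tsum_nonneg fun q => q.weight_nonneg ht
  have h1 : ∀ i k, ENNReal.ofReal (G.walkWeight t i k) =
      ∑' q : G.Walk i k, ENNReal.ofReal (q.weight t) := fun i k =>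
    ENNReal.ofReal_tsum_of_nonneg (fun q => q.weight_nonneg ht) (h i k)
  ext i k
  have h2 := tsum_walk ht (fun q => ENNReal.ofReal (q.weight t))
    (fun q => ENNReal.ofReal (q.weight t)) (fun i => by simp [Walk.weight])
    (fun e _ p => by rw [Walk.weight, ENNReal.ofReal_mul (mul_nonneg ht (G.weight_pos e).le)]) i k
  simp_rw [← h1] at h2
  have h3 : ∀ j, 0 ≤ t * G.adjMatrix i j := fun j => mul_nonneg ht (G.adjMatrix_nonneg i j)
  rw [show (if i = k then 1 else 0 : ℝ≥0∞) = ENNReal.ofReal ((1 : Matrix V V ℝ) i k) by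
    rw [Matrix.one_apply]; split_ifs <;> simp] at h2
  simp_rw [← ENNReal.ofReal_mul (h3 _)] at h2
  have h4 : 0 ≤ (1 : Matrix V V ℝ) i k := by rw [Matrix.one_apply]; split_ifs <;> simp
  have h5 : 0 ≤ ∑ j, t * G.adjMatrix i j * G.walkWeight t j k :=
    Finset.sum_nonneg fun j _ => mul_nonneg (h3 j) (h0 j k)
  rw [← ENNReal.ofReal_sum_of_nonneg (fun j _ => mul_nonneg (h3 j) (h0 j k)),
    ← ENNReal.ofReal_add h4 h5, ENNReal.ofReal_eq_ofReal_iff (h0 i k) (add_nonneg h4 h5)] at h2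
  simpa [Matrix.mul_apply, Finset.mul_sum, mul_assoc] using h2

end WeightedMultigraph

/-! ### Perron–Frobenius theory of the adjacency matrix. -/

namespace WeightedMultigraph

open Matrix
open scoped ENNReal

universe u v

variable {V : Type u} {E : Type v} {G : WeightedMultigraph V E} [DecidableEq V] [Fintype E]

/-- A set of vertices that is closed under adjacency and nonempty is everything. -/
theorem Connected.forall_of_adjMatrix_ne_zero (hG : G.Connected) {P : V → Prop} {i : V} (hi : P i)
    (h : ∀ i j, P i → G.adjMatrix i j ≠ 0 → P j) (j : V) : P j := by
  obtain ⟨p⟩ := hG i j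
  induction p with
  | nil => exact hi
  | cons e he p ih => exact ih (h _ _ hi (adjMatrix_pos he).ne')

theorem isHermitian_smul_one_sub_adjMatrix (r : ℝ) : (r • 1 - G.adjMatrix).IsHermitian := by
  ext i j
  simp [one_apply, adjMatrix_comm G i j, eq_comm]

variable [Fintype V]

theorem mulVec_smul_one_sub_eq_zero_iff {r : ℝ} {x : V → ℝ} :
    (r • 1 - G.adjMatrix) *ᵥ x = 0 ↔ G.adjMatrix *ᵥ x = r • x := by
  rw [sub_mulVec, smul_mulVec, one_mulVec, sub_eq_zero, eq_comm]

/-- A nonnegative eigenvector with a zero entry vanishes. -/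
theorem Connected.eq_zero_of_nonneg (hG : G.Connected) {r : ℝ} {y : V → ℝ} (hy : ∀ i, 0 ≤ y i)
    (hA : G.adjMatrix *ᵥ y = r • y) {i : V} (hi : y i = 0) : y = 0 := by
  funext j
  refine hG.forall_of_adjMatrix_ne_zero (P := fun j => y j = 0) hi (fun i j hi hij => ?_) j
  have h1 := congrFun hA i
  simp only [mulVec, dotProduct, Pi.smul_apply, hi, smul_zero] at h1
  rw [Finset.sum_eq_zero_iff_of_nonneg
    fun j _ => mul_nonneg (G.adjMatrix_nonneg i j) (hy j)] at h1
  exact (mul_eq_zero.1 (h1 j (Finset.mem_univ j))).resolve_left hij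

/-- The eigenspace of an eigenvalue with a positive eigenvector is one-dimensional. -/
theorem Connected.exists_eq_smul [Nonempty V] (hG : G.Connected) {r : ℝ} {p x : V → ℝ}
    (hp : ∀ i, 0 < p i) (hA : G.adjMatrix *ᵥ p = r • p) (hx : G.adjMatrix *ᵥ x = r • x) :
    ∃ c : ℝ, x = c • p := by
  -- With c the smallest ratio x_i / p_i, the eigenvector x - cp is nonnegative and has a zero
  -- entry.
  obtain ⟨i, hi⟩ := Finite.exists_min fun i => x i / p i
  refine ⟨x i / p i, sub_eq_zero.1 (hG.eq_zero_of_nonneg (r := r) (i := i) (fun j => ?_) ?_ ?_)⟩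
  · have := (le_div_iff₀ (hp j)).1 (hi j)
    simpa using this
  · rw [mulVec_sub, mulVec_smul, hA, hx, smul_sub, smul_comm]
  · simp [(hp i).ne']

/-- The quadratic form of the adjacency matrix attains its maximum on the unit sphere. -/
theorem exists_isMax_quadraticForm [Nonempty V] (G : WeightedMultigraph V E) :
    ∃ x : V → ℝ, x ⬝ᵥ x = 1 ∧
      ∀ y, y ⬝ᵥ G.adjMatrix *ᵥ y ≤ (x ⬝ᵥ G.adjMatrix *ᵥ x) * (y ⬝ᵥ y) := by
  have hcont : Continuous fun x : V → ℝ => x ⬝ᵥ x := by fun_prop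
  have hcomp : IsCompact {x : V → ℝ | x ⬝ᵥ x = 1} := by
    refine Metric.isCompact_of_isClosed_isBounded (isClosed_eq hcont continuous_const) ?_
    refine (Metric.isBounded_closedBall (x := (0 : V → ℝ)) (r := 1)).subset fun x hx => ?_
    rw [mem_closedBall_zero_iff, pi_norm_le_iff_of_nonneg zero_le_one]
    intro i
    have h1 : x i * x i ≤ x ⬝ᵥ x :=
      Finset.single_le_sum (f := fun i => x i * x i) (fun i _ => mul_self_nonneg _)
        (Finset.mem_univ i)
    rw [Set.mem_ofPred_eq] at hx
    rw [Real.norm_eq_abs, ← abs_one, ← sq_le_sq]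
    nlinarith
  have hne : {x : V → ℝ | x ⬝ᵥ x = 1}.Nonempty :=
    ⟨Pi.single (Classical.arbitrary V) 1, by simp⟩
  have hq : Continuous fun x : V → ℝ => x ⬝ᵥ G.adjMatrix *ᵥ x := by fun_prop
  obtain ⟨x, hx, hmax⟩ := hcomp.exists_isMaxOn hne hq.continuousOn
  refine ⟨x, hx, fun y => ?_⟩
  by_cases hy : y = 0
  · simp [hy]
  have hpos : 0 < y ⬝ᵥ y := lt_of_le_of_ne (Finset.sum_nonneg fun i _ => mul_self_nonneg _)
    (fun h => hy (dotProduct_self_eq_zero.1 h.symm))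
  have hs : √(y ⬝ᵥ y) * √(y ⬝ᵥ y) = y ⬝ᵥ y := Real.mul_self_sqrt hpos.le
  have hs0 : √(y ⬝ᵥ y) ≠ 0 := (Real.sqrt_pos.2 hpos).ne'
  have h1 := hmax (a := (√(y ⬝ᵥ y))⁻¹ • y) (by
    simp only [Set.mem_ofPred_eq, smul_dotProduct, dotProduct_smul, smul_eq_mul]
    rw [← mul_assoc, ← mul_inv, hs, inv_mul_cancel₀ hpos.ne'])
  simp only [Set.mem_ofPred_eq, smul_dotProduct, dotProduct_smul, smul_eq_mul, mulVec_smul] at h1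
  rwa [← mul_assoc, ← mul_inv, hs, inv_mul_le_iff₀ hpos, mul_comm] at h1

/-- The Perron vector of a connected graph. -/
theorem Connected.exists_perronVector [Nonempty V] (hG : G.Connected) :
    ∃ (r : ℝ) (p : V → ℝ), 0 ≤ r ∧ (∀ i, 0 < p i) ∧ p ⬝ᵥ p = 1 ∧ G.adjMatrix *ᵥ p = r • p ∧
      (r • 1 - G.adjMatrix).PosSemidef := by
  obtain ⟨x, hx, hmax⟩ := G.exists_isMax_quadraticForm
  set r := x ⬝ᵥ G.adjMatrix *ᵥ x with hr
  -- Since A has nonnegative entries, taking absolute values does not lower the quadratic form, so p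
  -- is again a maximizer and lies in the kernel of the semidefinite matrix rI - A.
  obtain ⟨p, hp⟩ : ∃ p : V → ℝ, p = fun i => |x i| := ⟨_, rfl⟩
  have hpp : p ⬝ᵥ p = 1 := by
    rw [← hx, hp]; exact Finset.sum_congr rfl fun i _ => abs_mul_abs_self _
  have hq : ∀ y : V → ℝ, star y ⬝ᵥ (r • 1 - G.adjMatrix) *ᵥ y =
      r * (y ⬝ᵥ y) - y ⬝ᵥ G.adjMatrix *ᵥ y := fun y => by
    rw [star_trivial, sub_mulVec, dotProduct_sub, smul_mulVec, one_mulVec, dotProduct_smul,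
      smul_eq_mul]
  have hpsd : (r • 1 - G.adjMatrix).PosSemidef := by
    refine PosSemidef.of_dotProduct_mulVec_nonneg (isHermitian_smul_one_sub_adjMatrix r) fun y => ?_
    rw [hq]
    exact sub_nonneg.2 (hmax y)
  have hle : r ≤ p ⬝ᵥ G.adjMatrix *ᵥ p := by
    simp only [hr, hp, dotProduct, mulVec, Finset.mul_sum]
    refine Finset.sum_le_sum fun i _ => Finset.sum_le_sum fun j _ => ?_
    calc x i * (G.adjMatrix i j * x j) ≤ |x i * (G.adjMatrix i j * x j)| := le_abs_self _
      _ = _ := by rw [abs_mul, abs_mul, abs_of_nonneg (G.adjMatrix_nonneg i j)]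
  have hzero : star p ⬝ᵥ (r • 1 - G.adjMatrix) *ᵥ p = 0 := by
    refine le_antisymm ?_ (hpsd.dotProduct_mulVec_nonneg p)
    rw [hq, hpp]
    linarith
  have hA : G.adjMatrix *ᵥ p = r • p :=
    mulVec_smul_one_sub_eq_zero_iff.1 ((hpsd.dotProduct_mulVec_zero_iff p).1 hzero)
  have hpos : ∀ i, 0 < p i := fun i => by
    have hp0 : ∀ i, 0 ≤ p i := fun i => hp ▸ abs_nonneg (x i)
    refine lt_of_le_of_ne (hp0 i) fun h => ?_
    rw [hG.eq_zero_of_nonneg hp0 hA h.symm] at hpp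
    simp at hpp
  refine ⟨r, p, ?_, hpos, hpp, hA, hpsd⟩
  obtain ⟨i⟩ := ‹Nonempty V›
  have h1 : 0 ≤ r * p i := by
    rw [← smul_eq_mul, ← Pi.smul_apply, ← hA]
    exact Finset.sum_nonneg fun j _ => mul_nonneg (G.adjMatrix_nonneg i j) (hpos j).le
  exact nonneg_of_mul_nonneg_left h1 (hpos i)

theorem _root_.Matrix.mem_spectrum_iff_exists_mulVec {K : Type*} [Field K] {A : Matrix V V K}
    {z : K} : z ∈ spectrum K A ↔ ∃ x ≠ 0, A *ᵥ x = z • x := by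
  rw [spectrum.mem_iff, isUnit_iff_isUnit_det, isUnit_iff_ne_zero, not_not,
    ← exists_mulVec_eq_zero_iff]
  simp_rw [sub_mulVec, Algebra.algebraMap_eq_smul_one, smul_mulVec, one_mulVec, sub_eq_zero,
    eq_comm]

/-- An eigenvalue with a positive eigenvector is the spectral radius. -/
theorem perronRoot_eq [Nonempty V] {r : ℝ} (hr : 0 ≤ r) {p : V → ℝ} (hp : ∀ i, 0 < p i)
    (hA : G.adjMatrix *ᵥ p = r • p) : G.perronRoot = r := by
  have h : spectralRadius ℂ (G.adjMatrix.map Complex.ofReal) = ENNReal.ofReal r := by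
    refine le_antisymm (iSup₂_le fun z hz => ?_) ?_
    · obtain ⟨x, hx0, hx⟩ := mem_spectrum_iff_exists_mulVec.1 hz
      have h1 : ∀ i, ‖z‖ * ‖x i‖ ≤ ∑ j, G.adjMatrix i j * ‖x j‖ := fun i => by
        have h2 := congrFun hx i
        simp only [mulVec, dotProduct, map_apply, Pi.smul_apply, smul_eq_mul] at h2
        rw [← norm_mul, ← h2]
        refine (norm_sum_le _ _).trans (Finset.sum_le_sum fun j _ => ?_)
        rw [norm_mul, Complex.norm_real, Real.norm_of_nonneg (G.adjMatrix_nonneg i j)]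
      -- Pair the entrywise inequality |z||x| ≤ A|x| with p; by symmetry A moves over to p and
      -- becomes r.
      have h3 : ‖z‖ * ∑ i, p i * ‖x i‖ ≤ r * ∑ i, p i * ‖x i‖ := by
        calc ‖z‖ * ∑ i, p i * ‖x i‖ = ∑ i, p i * (‖z‖ * ‖x i‖) := by
              rw [Finset.mul_sum]; exact Finset.sum_congr rfl fun i _ => by ring
          _ ≤ ∑ i, p i * ∑ j, G.adjMatrix i j * ‖x j‖ :=
              Finset.sum_le_sum fun i _ => mul_le_mul_of_nonneg_left (h1 i) (hp i).le
          _ = ∑ j, (∑ i, G.adjMatrix j i * p i) * ‖x j‖ := by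
              simp_rw [Finset.mul_sum, Finset.sum_mul]
              rw [Finset.sum_comm]
              refine Finset.sum_congr rfl fun j _ => Finset.sum_congr rfl fun i _ => ?_
              rw [adjMatrix_comm G i j]; ring
          _ = ∑ j, (r * p j) * ‖x j‖ :=
              Finset.sum_congr rfl fun j _ => congrArg (· * ‖x j‖) (congrFun hA j)
          _ = _ := by rw [Finset.mul_sum]; exact Finset.sum_congr rfl fun i _ => by ring
      have h4 : 0 < ∑ i, p i * ‖x i‖ := by
        obtain ⟨i, hi⟩ := Function.ne_iff.1 hx0
        exact Finset.sum_pos' (fun i _ => mul_nonneg (hp i).le (norm_nonneg _))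
          ⟨i, Finset.mem_univ i, mul_pos (hp i) (norm_pos_iff.2 hi)⟩
      rw [← enorm_eq_nnnorm, ← ofReal_norm]
      exact ENNReal.ofReal_le_ofReal (le_of_mul_le_mul_right h3 h4)
    · have hmem : (r : ℂ) ∈ spectrum ℂ (G.adjMatrix.map Complex.ofReal) := by
        refine mem_spectrum_iff_exists_mulVec.2 ⟨fun i => (p i : ℂ), ?_, ?_⟩
        · obtain ⟨i⟩ := ‹Nonempty V›
          exact Function.ne_iff.2 ⟨i, by simpa using (hp i).ne'⟩
        · ext i
          have h2 := congrArg Complex.ofReal (congrFun hA i)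
          simpa [mulVec, dotProduct] using h2
      refine le_trans (le_of_eq ?_) (le_iSup₂ (f := fun z _ => (‖z‖₊ : ℝ≥0∞)) (r : ℂ) hmem)
      rw [← enorm_eq_nnnorm, ← ofReal_norm, Complex.norm_real, Real.norm_of_nonneg hr]
  rw [perronRoot, h, ENNReal.toReal_ofReal hr]

end WeightedMultigraph

/-! ### Resolvent near a simple eigenvalue. -/

namespace Matrix

variable {V : Type*} [Fintype V] [DecidableEq V]

/-- The resolvent of a matrix `Q` with simple eigenvalue `0` and unit eigenvector `p`, on both
sides. -/
theorem eq_of_add_smul_one_mul_eq_one {Q W : Matrix V V ℝ} {p : V → ℝ} (hpp : p ⬝ᵥ p = 1)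
    (hQ : Q *ᵥ p = 0) (hsymm : Q.IsSymm) {ε : ℝ} (hε : 0 < ε)
    (hS : IsUnit (Q + vecMulVec p p + ε • 1).det) (hW : (Q + ε • 1) * W = 1) :
    W = (Q + vecMulVec p p + ε • 1)⁻¹ + (ε⁻¹ - (1 + ε)⁻¹) • vecMulVec p p := by
  set P := vecMulVec p p
  set M := (Q + P + ε • 1)⁻¹
  have hε' : 1 + ε ≠ 0 := by positivity
  have hPP : P * P = P := by
    rw [vecMulVec_mul_vecMulVec, hpp, one_smul]
  have hQP : Q * P = 0 := by rw [mul_vecMulVec, hQ, zero_vecMulVec]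
  have hPQ : P * Q = 0 := by
    rw [vecMulVec_mul, ← mulVec_transpose, hsymm.eq, hQ, vecMulVec_zero]
  have hM : (Q + P + ε • 1) * M = 1 := mul_nonsing_inv _ hS
  have hPM : (1 + ε) • (P * M) = P := by
    have h1 : P * (Q + P + ε • 1) = (1 + ε) • P := by
      rw [mul_add, mul_add, hPQ, hPP, mul_smul_comm, mul_one, zero_add, add_smul, one_smul]
    rw [← smul_mul_assoc, ← h1, mul_assoc, hM, mul_one]
  have hPM' : P * M = (1 + ε)⁻¹ • P := by
    nth_rw 2 [← hPM]
    rw [smul_smul, inv_mul_cancel₀ hε', one_smul]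
  have hQM : (Q + ε • 1) * M = 1 - (1 + ε)⁻¹ • P := by
    rw [← hPM', eq_sub_iff_add_eq, ← add_mul, add_right_comm, hM]
  -- On p the matrices Q + ε and Q + P + ε act as ε and 1 + ε; the difference of the reciprocals is
  -- the correction along P.
  have hc : (Q + ε • 1) * (M + (ε⁻¹ - (1 + ε)⁻¹) • P) = 1 := by
    rw [mul_add, hQM, mul_smul_comm, add_mul, hQP, smul_mul_assoc, one_mul, zero_add, smul_smul,
      show (ε⁻¹ - (1 + ε)⁻¹) * ε = (1 + ε)⁻¹ by field_simp; ring]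
    abel
  calc W = 1 * W := (one_mul W).symm
    _ = _ := by
      rw [← mul_eq_one_comm.1 hc, mul_assoc, hW, mul_one]

theorem tendsto_inv_add_smul_one {S : Matrix V V ℝ} (hS : IsUnit S.det) (i j : V) :
    Tendsto (fun ε : ℝ => (S + ε • 1)⁻¹ i j) (𝓝 0) (𝓝 (S⁻¹ i j)) := by
  have h : ContinuousAt (fun ε : ℝ => (S + ε • 1).det⁻¹ * (S + ε • 1).adjugate i j) 0 := by
    refine ContinuousAt.mul (ContinuousAt.inv₀ ?_ (by simpa using hS.ne_zero)) ?_
    · exact (Continuous.matrix_det (by fun_prop)).continuousAt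
    · exact ((Continuous.matrix_adjugate (by fun_prop)).matrix_elem i j).continuousAt
  have h2 : ∀ ε : ℝ, (S + ε • 1)⁻¹ i j = (S + ε • 1).det⁻¹ * (S + ε • 1).adjugate i j := fun ε => by
    rw [inv_def, Ring.inverse_eq_inv', smul_apply, smul_eq_mul]
  have h3 := h.tendsto
  simp_rw [← h2] at h3
  simpa using h3

end Matrix

/-! ### Asymptotics of the scaling factor. -/

namespace WeightedMultigraph

/-- `θ(α) / α → 2 / n` for `α → ∞`. -/
theorem tendsto_scalingFactor_div (n : ℕ) (hn : 0 < n) :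
    Tendsto (fun α : ℝ => scalingFactor n α / α) atTop (𝓝 (2 / n)) := by
  set s : ℝ := 2 / n
  have hs : 0 < s := by positivity
  have h1 : Tendsto (fun α : ℝ => Real.log (1 + Real.exp 1 * α ^ (-s))) atTop (𝓝 0) := by
    have : Tendsto (fun α : ℝ => 1 + Real.exp 1 * α ^ (-s)) atTop (𝓝 (1 + Real.exp 1 * 0)) :=
      ((tendsto_rpow_neg_atTop hs).const_mul _).const_add _
    simpa using this.log (by simp)
  have h2 : Tendsto (fun α : ℝ => (s + Real.log (1 + Real.exp 1 * α ^ (-s)) * (Real.log α)⁻¹) *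
      (1 - α⁻¹)) atTop (𝓝 ((s + 0 * 0) * (1 - 0))) :=
    ((h1.mul Real.tendsto_log_atTop.inv_tendsto_atTop).const_add s).mul
      (tendsto_inv_atTop_zero.const_sub 1)
  simp only [mul_zero, add_zero, sub_zero, mul_one] at h2
  refine h2.congr' ?_
  filter_upwards [eventually_gt_atTop 1] with α hα
  have h0 : 0 < α := by linarith
  have hlog : Real.log α ≠ 0 := (Real.log_pos hα).ne'
  -- Taking α^s out of the logarithm isolates s log α, so division by log α leaves s = 2/n in the
  -- limit.
  have h3 : Real.log (Real.exp 1 + α ^ s) =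
      s * Real.log α + Real.log (1 + Real.exp 1 * α ^ (-s)) := by
    rw [← Real.log_rpow h0, ← Real.log_mul (by positivity) (by positivity), mul_add, mul_one,
      mul_left_comm, ← Real.rpow_add h0, add_neg_cancel, Real.rpow_zero, mul_one, add_comm]
  rw [scalingFactor, if_neg hα.ne', h3]
  field_simp

end WeightedMultigraph

/-! ### The Perron kernel and the limit of the scaled walk distances. -/

namespace WeightedMultigraph

open Matrix

universe u v

/-- A function that is superharmonic at `k` and has a minimum among the neighbours of `k` at `k`
is constant on them. -/
theorem eq_of_superharmonic_of_le {V : Type*} [Fintype V] {w : V → V → ℝ} (hw : ∀ k l, 0 ≤ w k l) {f : V → ℝ} {k : V}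
    (hf : 0 ≤ ∑ l, w k l * (f k - f l)) (hmin : ∀ l, w k l ≠ 0 → f k ≤ f l) {l : V}
    (hl : w k l ≠ 0) : f l = f k := by
  have h1 : ∀ l ∈ Finset.univ, w k l * (f k - f l) ≤ 0 := fun l _ => by
    by_cases h : w k l = 0
    · simp [h]
    · exact mul_nonpos_of_nonneg_of_nonpos (hw k l) (by linarith [hmin l h])
  have h2 := (Finset.sum_eq_zero_iff_of_nonpos h1).1 (le_antisymm (Finset.sum_nonpos h1) hf) l
    (Finset.mem_univ l)
  linarith [(mul_eq_zero.1 h2).resolve_left hl]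

variable {V : Type u} {E : Type v} {G : WeightedMultigraph V E} [Fintype V] [DecidableEq V]
  [Fintype E]

/-- The data of a Perron eigenvalue `r` and a positive unit eigenvector `p` of the adjacency
matrix. -/
structure IsPerronPair (G : WeightedMultigraph V E) (r : ℝ) (p : V → ℝ) : Prop where
  nonneg : 0 ≤ r
  pos : ∀ i, 0 < p i
  dotProduct_self : p ⬝ᵥ p = 1
  mulVec_eq : G.adjMatrix *ᵥ p = r • p
  posSemidef : (r • 1 - G.adjMatrix).PosSemidef

/-- The positive definite matrix `r I - A + p pᵀ`. -/
def perronMatrix (G : WeightedMultigraph V E) (r : ℝ) (p : V → ℝ) : Matrix V V ℝ :=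
  r • 1 - G.adjMatrix + vecMulVec p p

/-- The matrix with entries `(r I - A + p pᵀ)⁻¹ i j / (p i * p j)`. -/
noncomputable def perronKernel (G : WeightedMultigraph V E) (r : ℝ) (p : V → ℝ) (i j : V) : ℝ :=
  (G.perronMatrix r p)⁻¹ i j / (p i * p j)

namespace IsPerronPair

variable {r : ℝ} {p : V → ℝ}

/-- If both quadratic forms vanish at x, then x is a multiple of p by simplicity of r, and it is
orthogonal to p, hence zero. -/
theorem posDef [Nonempty V] (h : G.IsPerronPair r p) (hG : G.Connected) :
    (G.perronMatrix r p).PosDef := by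
  have hP : (vecMulVec p p).PosSemidef := by
    simpa using posSemidef_vecMulVec_self_star p
  have hq : ∀ x : V → ℝ, star x ⬝ᵥ vecMulVec p p *ᵥ x = (p ⬝ᵥ x) * (p ⬝ᵥ x) := fun x => by
    rw [star_trivial, vecMulVec_mulVec, op_smul_eq_smul, dotProduct_smul, smul_eq_mul,
      dotProduct_comm x p]
  refine PosDef.of_dotProduct_mulVec_pos (h.posSemidef.add hP).isHermitian fun x hx => ?_
  rw [perronMatrix, add_mulVec, dotProduct_add]
  have h1 := h.posSemidef.dotProduct_mulVec_nonneg x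
  have h2 := hP.dotProduct_mulVec_nonneg x
  refine lt_of_le_of_ne (add_nonneg h1 h2) fun h0 => hx ?_
  have h3 : star x ⬝ᵥ (r • 1 - G.adjMatrix) *ᵥ x = 0 := by linarith
  have h4 : star x ⬝ᵥ vecMulVec p p *ᵥ x = 0 := by linarith
  obtain ⟨c, rfl⟩ := hG.exists_eq_smul h.pos h.mulVec_eq
    (mulVec_smul_one_sub_eq_zero_iff.1 ((h.posSemidef.dotProduct_mulVec_zero_iff x).1 h3))
  rw [hq, dotProduct_smul, h.dotProduct_self] at h4
  simp at h4
  simp [h4]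

theorem isUnit_det [Nonempty V] (h : G.IsPerronPair r p) (hG : G.Connected) :
    IsUnit (G.perronMatrix r p).det :=
  (isUnit_iff_isUnit_det _).1 (h.posDef hG).isUnit

theorem isUnit_det_add [Nonempty V] (h : G.IsPerronPair r p) (hG : G.Connected) {ε : ℝ}
    (hε : 0 < ε) : IsUnit (G.perronMatrix r p + ε • 1).det :=
  (isUnit_iff_isUnit_det _).1 ((h.posDef hG).add (PosDef.one.smul hε)).isUnit

theorem tParam_eq [Nonempty V] (h : G.IsPerronPair r p) (α : ℝ) :
    G.tParam α = (r + α⁻¹)⁻¹ := by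
  rw [tParam, perronRoot_eq h.nonneg h.pos h.mulVec_eq]

theorem walkWeightsFinite [Nonempty V] (h : G.IsPerronPair r p) {α : ℝ} (hα : 0 < α) :
    G.WalkWeightsFinite (G.tParam α) := by
  have hr := h.nonneg
  have hα' : 0 < α⁻¹ := inv_pos.2 hα
  rw [h.tParam_eq]
  refine walkWeightsFinite_of_eigenvector (s := (r + α⁻¹)⁻¹ * r) (by positivity) (by positivity)
    ?_ h.pos fun i => ?_
  · rw [inv_mul_lt_iff₀ (by positivity)]
    linarith
  · simp_rw [mul_assoc]
    rw [← Finset.mul_sum]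
    exact congrArg _ (congrFun h.mulVec_eq i)

/-- The walk weights in terms of the regularized resolvent. -/
theorem walkWeight_eq [Nonempty V] (h : G.IsPerronPair r p) (hG : G.Connected) {α : ℝ}
    (hα : 0 < α) (i j : V) :
    G.walkWeight (G.tParam α) i j = (r + α⁻¹) * (α * (1 + α⁻¹)⁻¹) * (p i * p j) *
      (1 + α⁻¹ * (1 + α⁻¹) * ((G.perronMatrix r p + α⁻¹ • 1)⁻¹ i j / (p i * p j))) := by
  have hr := h.nonneg
  have hα' : 0 < α⁻¹ := inv_pos.2 hα
  have hc : r + α⁻¹ ≠ 0 := by positivity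
  have ht : 0 ≤ G.tParam α := by rw [h.tParam_eq]; positivity
  have hW := (h.walkWeightsFinite hα).walkWeight_eq ht
  set W := Matrix.of (G.walkWeight (G.tParam α)) with hWdef
  -- Multiplying R = I + tAR by t⁻¹ = r + α⁻¹ turns it into a resolvent equation with ε = α⁻¹.
  have hW' : (r • 1 - G.adjMatrix + α⁻¹ • 1) * ((r + α⁻¹)⁻¹ • W) = 1 := by
    have h1 : r • 1 - G.adjMatrix + α⁻¹ • 1 = (r + α⁻¹) • (1 - G.tParam α • G.adjMatrix) := by
      rw [smul_sub, smul_smul, h.tParam_eq, mul_inv_cancel₀ hc, one_smul, add_smul]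
      abel
    rw [h1, smul_mul_assoc, mul_smul_comm, smul_smul, mul_inv_cancel₀ hc, one_smul, sub_mul,
      one_mul, sub_eq_iff_eq_add]
    exact hW
  have h2 := eq_of_add_smul_one_mul_eq_one h.dotProduct_self
    (mulVec_smul_one_sub_eq_zero_iff.2 h.mulVec_eq)
    (by simpa [IsHermitian, IsSymm] using isHermitian_smul_one_sub_adjMatrix (G := G) r)
    hα' (h.isUnit_det_add hG hα') hW'
  have h3 := congrFun (congrFun h2 i) j
  simp only [Matrix.smul_apply, Matrix.add_apply, vecMulVec_apply, smul_eq_mul, hWdef, of_apply] at h3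
  rw [inv_mul_eq_iff_eq_mul₀ hc] at h3
  have hi := (h.pos i).ne'
  have hj := (h.pos j).ne'
  have h1' : 1 + α⁻¹ ≠ 0 := by positivity
  rw [h3, perronMatrix, mul_assoc (r + α⁻¹), mul_assoc (r + α⁻¹)]
  congr 1
  rw [inv_inv]
  have h5 : α * (1 + α⁻¹)⁻¹ * α⁻¹ * (1 + α⁻¹) = 1 := by field_simp
  -- This coefficient of ppᵀ carries the divergence as α → ∞; factoring it out leaves 1 plus a term
  -- of order α⁻¹.
  have h6 : α - (1 + α⁻¹)⁻¹ = α * (1 + α⁻¹)⁻¹ := by field_simp; ring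
  rw [h6, mul_add, mul_one, add_comm]
  congr 1
  generalize (r • 1 - G.adjMatrix + vecMulVec p p + α⁻¹ • 1 : Matrix V V ℝ)⁻¹ i j = m
  calc m = α * (1 + α⁻¹)⁻¹ * α⁻¹ * (1 + α⁻¹) * m := by rw [h5, one_mul]
    _ = _ := by
      generalize (1 + α⁻¹)⁻¹ = a
      generalize α⁻¹ = b
      field_simp

/-- In d_t only the terms log(1 + g) survive, and α log(1 + g) tends to the kernel because αg does;
the remaining factor θ/α tends to 2/n. -/
theorem tendsto_scaledWalkDist [Nonempty V] (h : G.IsPerronPair r p) (hG : G.Connected)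
    (i j : V) :
    Tendsto (fun α : ℝ => G.scaledWalkDist α i j) atTop (𝓝 ((Fintype.card V : ℝ)⁻¹ *
      (G.perronKernel r p i i + G.perronKernel r p j j - 2 * G.perronKernel r p i j))) := by
  set g : V → V → ℝ → ℝ := fun i j α =>
    α⁻¹ * (1 + α⁻¹) * ((G.perronMatrix r p + α⁻¹ • 1)⁻¹ i j / (p i * p j)) with hg
  have hM : ∀ i j, Tendsto (fun α : ℝ => (1 + α⁻¹) *
      ((G.perronMatrix r p + α⁻¹ • 1)⁻¹ i j / (p i * p j))) atTop
      (𝓝 (G.perronKernel r p i j)) := fun i j => by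
    have := (tendsto_inv_atTop_zero (𝕜 := ℝ).const_add 1).mul
      (((tendsto_inv_add_smul_one (h.isUnit_det hG) i j).comp
        (tendsto_inv_atTop_zero (𝕜 := ℝ))).div_const (p i * p j))
    simpa [perronKernel] using this
  have hg0 : ∀ i j, Tendsto (g i j) atTop (𝓝 0) := fun i j => by
    have := (tendsto_inv_atTop_zero (𝕜 := ℝ)).mul (hM i j)
    simpa [hg, mul_assoc] using this
  have hg1 : ∀ i j, Tendsto (fun α : ℝ => α * Real.log (1 + g i j α)) atTop
      (𝓝 (G.perronKernel r p i j)) := fun i j => by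
    refine Real.tendsto_mul_log_one_add_of_tendsto ((hM i j).congr' ?_)
    filter_upwards [eventually_gt_atTop 0] with α hα
    rw [hg]
    field_simp
  have hpos : ∀ i j, ∀ᶠ α in atTop, 0 < 1 + g i j α := fun i j => by
    have := (hg0 i j).const_add 1
    rw [add_zero] at this
    exact this.eventually_const_lt one_pos
  have hlim := (tendsto_scalingFactor_div (Fintype.card V) Fintype.card_pos).mul
    ((((hg1 i i).add (hg1 j j)).div_const 2).sub (hg1 i j))
  rw [show (Fintype.card V : ℝ)⁻¹ *
      (G.perronKernel r p i i + G.perronKernel r p j j - 2 * G.perronKernel r p i j) =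
      2 / (Fintype.card V : ℝ) * ((G.perronKernel r p i i + G.perronKernel r p j j) / 2 -
        G.perronKernel r p i j) by ring]
  refine hlim.congr' ?_
  filter_upwards [eventually_gt_atTop 0, hpos i i, hpos j j, hpos i j] with α hα hii hjj hij
  have hr := h.nonneg
  have hα' : 0 < α⁻¹ := inv_pos.2 hα
  have hc : (r + α⁻¹) * (α * (1 + α⁻¹)⁻¹) ≠ 0 := by positivity
  have hlog : ∀ i j, 0 < 1 + g i j α → Real.log (G.walkWeight (G.tParam α) i j) =
      Real.log ((r + α⁻¹) * (α * (1 + α⁻¹)⁻¹)) + (Real.log (p i) + Real.log (p j)) +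
        Real.log (1 + g i j α) := fun i j h1 => by
    have hi := (h.pos i).ne'
    have hj := (h.pos j).ne'
    rw [h.walkWeight_eq hG hα, Real.log_mul (mul_ne_zero hc (mul_ne_zero hi hj)) h1.ne',
      Real.log_mul hc (mul_ne_zero hi hj), Real.log_mul hi hj]
  rw [scaledWalkDist, walkDist, hlog i i hii, hlog j j hjj, hlog i j hij]
  field_simp
  ring

/-! ### Current equation and minimum principle. -/

/-- The columns of the kernel are the potentials of unit currents for the edge weights
`p k * a k l * p l`. -/
theorem sum_mul_sub_perronKernel [Nonempty V] (h : G.IsPerronPair r p) (hG : G.Connected)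
    (k i : V) :
    ∑ l, p k * G.adjMatrix k l * p l * (G.perronKernel r p k i - G.perronKernel r p l i) =
      (if k = i then 1 else 0) - p k ^ 2 := by
  set M := (G.perronMatrix r p)⁻¹ with hMdef
  have hSM : G.perronMatrix r p * M = 1 := mul_nonsing_inv _ (h.isUnit_det hG)
  have hS : G.perronMatrix r p *ᵥ p = p := by
    rw [perronMatrix, add_mulVec, mulVec_smul_one_sub_eq_zero_iff.2 h.mulVec_eq, vecMulVec_mulVec,
      h.dotProduct_self]
    simp
  have hSt : (G.perronMatrix r p)ᵀ = G.perronMatrix r p := by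
    simpa [IsHermitian] using (h.posDef hG).isHermitian
  -- As p is fixed by the symmetric Perron matrix, it is fixed by the inverse; thus ppᵀM = ppᵀ, the
  -- origin of the background term -p_k².
  have hpM : p ᵥ* M = p := by
    calc p ᵥ* M = (p ᵥ* G.perronMatrix r p) ᵥ* M := by
          rw [← mulVec_transpose (G.perronMatrix r p), hSt, hS]
      _ = p := by rw [vecMul_vecMul, hSM, vecMul_one]
  have h1 := congrFun (congrFun hSM k) i
  rw [perronMatrix, add_mul, sub_mul, smul_mul_assoc, one_mul, vecMulVec_mul, hpM, Matrix.add_apply,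
    Matrix.sub_apply, Matrix.smul_apply, vecMulVec_apply, one_apply, smul_eq_mul, mul_apply] at h1
  have hA := congrFun h.mulVec_eq k
  simp only [mulVec, dotProduct, Pi.smul_apply, smul_eq_mul] at hA
  have hk := (h.pos k).ne'
  have hi := (h.pos i).ne'
  have h2 : ∑ l, p k * G.adjMatrix k l * p l * (G.perronKernel r p k i - G.perronKernel r p l i) =
      (∑ l, G.adjMatrix k l * p l) * (M k i / p i) -
        (∑ l, G.adjMatrix k l * M l i) * (p k / p i) := by
    rw [Finset.sum_mul, Finset.sum_mul, ← Finset.sum_sub_distrib]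
    refine Finset.sum_congr rfl fun l _ => ?_
    have hl := (h.pos l).ne'
    rw [perronKernel, perronKernel, ← hMdef]
    field_simp
  rw [h2, hA]
  have h3 : ∑ l, G.adjMatrix k l * M l i = r * M k i + p k * p i - if k = i then 1 else 0 := by
    linarith
  rw [h3]
  by_cases hki : k = i
  · subst hki
    simp only [if_true]
    field_simp
    ring
  · simp only [hki, if_false]
    field_simp
    ring

theorem perronKernel_comm [Nonempty V] (h : G.IsPerronPair r p) (hG : G.Connected) (i j : V) :
    G.perronKernel r p i j = G.perronKernel r p j i := by
  have := (h.posDef hG).inv.isHermitian.apply i j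
  rw [perronKernel, perronKernel, ← this, star_trivial, mul_comm (p i)]

end IsPerronPair

/-- Minimum principle: a function that is superharmonic on a set `C` with boundary in `{j}` is
bounded below on `C` by its value at `j`. -/
theorem Connected.le_of_superharmonic (hG : G.Connected) {w : V → V → ℝ} (hw : ∀ k l, 0 ≤ w k l)
    (hwG : ∀ k l, w k l ≠ 0 ↔ G.adjMatrix k l ≠ 0) {f : V → ℝ} {C : V → Prop} {j : V} (hj : ¬ C j)
    (hC : ∀ k l, C k → w k l ≠ 0 → C l ∨ l = j)
    (hf : ∀ k, C k → 0 ≤ ∑ l, w k l * (f k - f l)) {k : V} (hk : C k) : f j ≤ f k := by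
  obtain ⟨a, ha, hmin⟩ := Set.exists_min_image {l | C l ∨ l = j} f (Set.toFinite _) ⟨j, Or.inr rfl⟩
  have hja : f j = f a := by
    rcases ha with ha | rfl
    -- Minimality spreads from a through C by adjacency until it reaches j. The second alternative
    -- is the desired conclusion itself, so that it persists trivially once attained.
    · have := hG.forall_of_adjMatrix_ne_zero (P := fun l => (f l = f a ∧ C l) ∨ f j = f a)
        (Or.inl ⟨rfl, ha⟩) (fun b c hb hbc => ?_) j
      · exact this.elim And.left id
      rcases hb with ⟨hb, hbC⟩ | hb
      · rw [← hwG] at hbc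
        have hcb : f c = f b := eq_of_superharmonic_of_le hw (hf b hbC)
          (fun l hl => hb ▸ hmin l (hC b l hbC hl)) hbc
        rcases hC b c hbC hbc with hc | rfl
        · exact Or.inl ⟨hcb.trans hb, hc⟩
        · exact Or.inr (hcb.trans hb)
      · exact Or.inr hb
    · rfl
  exact hja ▸ hmin k (Or.inl hk)

/-- A function that is superharmonic outside `j` and takes its minimum over all vertices at `i`
is harmonic at all vertices reachable from `i` by walks that avoid `j`. -/
theorem harmonic_of_isMin {w : V → V → ℝ} (hw : ∀ k l, 0 ≤ w k l)
    (hwG : ∀ k l, w k l ≠ 0 ↔ G.adjMatrix k l ≠ 0) {f : V → ℝ} {j : V}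
    (hf : ∀ k, k ≠ j → 0 ≤ ∑ l, w k l * (f k - f l)) {i k : V} (q : G.Walk i k)
    (hq : j ∉ q.support) (hi : ∀ l, f i ≤ f l) : ∑ l, w k l * (f k - f l) = 0 := by
  have key : ∀ k, k ≠ j → (∀ l, f k ≤ f l) → ∀ l, w k l ≠ 0 → f l = f k := fun k hkj hk l hl =>
    eq_of_superharmonic_of_le hw (hf k hkj) (fun l _ => hk l) hl
  induction q with
  | @nil i =>
    have hij : i ≠ j := by
      rintro rfl
      simp [Walk.support] at hq
    refine Finset.sum_eq_zero fun l _ => ?_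
    by_cases h : w i l = 0
    · simp [h]
    · simp [key i hij hi l h]
  | @cons i l k e he q ih =>
    simp only [Walk.support, List.mem_cons, not_or] at hq
    have h1 := key i (Ne.symm hq.1) hi l ((hwG i l).2 (adjMatrix_pos he).ne')
    exact ih hq.2 (fun l' => h1 ▸ hi l')

/-- The distance that a kernel defines. -/
noncomputable def perronDist (G : WeightedMultigraph V E) (r : ℝ) (p : V → ℝ) (i j : V) : ℝ :=
  (Fintype.card V : ℝ)⁻¹ *
    (G.perronKernel r p i i + G.perronKernel r p j j - 2 * G.perronKernel r p i j)

/-- The triangle defect is the rise from j to i of a single potential, so both the inequality and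
its equality case concern where that potential is minimal. -/
theorem perronDist_add_sub (G : WeightedMultigraph V E) (r : ℝ) (p : V → ℝ) (i j k : V) :
    G.perronDist r p i j + G.perronDist r p j k - G.perronDist r p i k =
      (Fintype.card V : ℝ)⁻¹ * 2 * ((G.perronKernel r p i k - G.perronKernel r p i j) -
        (G.perronKernel r p j k - G.perronKernel r p j j)) := by
  simp only [perronDist]
  ring

/-! ### Metric, geodetic and Euclidean properties of the limit. -/

namespace IsPerronPair

variable {r : ℝ} {p : V → ℝ}

theorem conductance_nonneg (h : G.IsPerronPair r p) (k l : V) :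
    0 ≤ p k * G.adjMatrix k l * p l :=
  mul_nonneg (mul_nonneg (h.pos k).le (G.adjMatrix_nonneg k l)) (h.pos l).le

theorem conductance_ne_zero_iff (h : G.IsPerronPair r p) (k l : V) :
    p k * G.adjMatrix k l * p l ≠ 0 ↔ G.adjMatrix k l ≠ 0 := by
  simp [(h.pos k).ne', (h.pos l).ne']

variable [Nonempty V]

/-- The background term -p_l² does not depend on the column and cancels in the difference, leaving a
unit source at k and a unit sink at j. -/
theorem sum_mul_potential (h : G.IsPerronPair r p) (hG : G.Connected) (k j l : V) :
    ∑ m, p l * G.adjMatrix l m * p m *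
      ((G.perronKernel r p l k - G.perronKernel r p l j) -
        (G.perronKernel r p m k - G.perronKernel r p m j)) =
      (if l = k then 1 else 0) - (if l = j then 1 else 0) := by
  have h1 := h.sum_mul_sub_perronKernel hG l k
  have h2 := h.sum_mul_sub_perronKernel hG l j
  rw [← sub_sub_sub_cancel_right (if l = k then (1 : ℝ) else 0) _ (p l ^ 2), ← h1, ← h2, ← Finset.sum_sub_distrib]
  exact Finset.sum_congr rfl fun m _ => by ring

theorem potential_superharmonic (h : G.IsPerronPair r p) (hG : G.Connected) {k j l : V}
    (hl : l ≠ j) : 0 ≤ ∑ m, p l * G.adjMatrix l m * p m *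
      ((G.perronKernel r p l k - G.perronKernel r p l j) -
        (G.perronKernel r p m k - G.perronKernel r p m j)) := by
  rw [h.sum_mul_potential hG, if_neg hl]
  split_ifs <;> simp

theorem potential_le (h : G.IsPerronPair r p) (hG : G.Connected) (k j l : V) :
    G.perronKernel r p j k - G.perronKernel r p j j ≤
      G.perronKernel r p l k - G.perronKernel r p l j := by
  by_cases hl : l = j
  · rw [hl]
  · exact hG.le_of_superharmonic (f := fun l => G.perronKernel r p l k - G.perronKernel r p l j)
      (C := (· ≠ j)) h.conductance_nonneg h.conductance_ne_zero_iff
      (by simp) (fun _ l _ _ => ne_or_eq l j) (fun l hl => h.potential_superharmonic hG hl) hl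

/-- Along a walk from i to k avoiding j, a minimum at i would spread to k and make the potential
harmonic at the source. Conversely, if j cuts i off from k, the region cut off contains no source,
so the minimum principle also applies to the negated potential. -/
theorem potential_eq_iff (h : G.IsPerronPair r p) (hG : G.Connected) (i j k : V) :
    G.perronKernel r p i k - G.perronKernel r p i j =
      G.perronKernel r p j k - G.perronKernel r p j j ↔ ∀ q : G.Walk i k, j ∈ q.support := by
  constructor
  · intro heq q
    by_contra hq
    have h0 := harmonic_of_isMin
      (f := fun l => G.perronKernel r p l k - G.perronKernel r p l j) h.conductance_nonneg
      h.conductance_ne_zero_iff (fun l hl => h.potential_superharmonic hG hl) q hq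
      (fun l => heq ▸ h.potential_le hG k j l)
    have hkj : k ≠ j := fun hkj => hq (hkj ▸ q.end_mem_support)
    simp only [h.sum_mul_potential hG] at h0
    simp [hkj] at h0
  · intro hq
    refine le_antisymm ?_ (h.potential_le hG k j i)
    by_cases hij : i = j
    · rw [hij]
    have h1 := hG.le_of_superharmonic (j := j) (k := i)
      (f := fun l => -(G.perronKernel r p l k - G.perronKernel r p l j))
      (C := fun l => l ≠ j ∧ ∀ q : G.Walk l k, j ∈ q.support) h.conductance_nonneg
      h.conductance_ne_zero_iff (by simp) ?_ ?_ ⟨hij, hq⟩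
    · exact neg_le_neg_iff.1 h1
    · rintro l m ⟨hlj, hl⟩ hlm
      by_cases hm : m = j
      · exact Or.inr hm
      · refine Or.inl ⟨hm, fun q => ?_⟩
        obtain ⟨e, he⟩ := exists_ends_of_adjMatrix_ne_zero ((h.conductance_ne_zero_iff l m).1 hlm)
        have := hl (Walk.cons e he q)
        rw [Walk.support, List.mem_cons] at this
        exact this.resolve_left (Ne.symm hlj)
    · rintro l ⟨hlj, hl⟩
      have hlk : l ≠ k := by
        rintro rfl
        have := hl Walk.nil
        rw [Walk.support, List.mem_singleton] at this
        exact hlj this.symm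
      have h2 := h.sum_mul_potential hG k j l
      rw [if_neg hlj, if_neg hlk, sub_zero] at h2
      refine le_of_eq ?_
      rw [← neg_zero, ← h2, ← Finset.sum_neg_distrib]
      exact Finset.sum_congr rfl fun m _ => by ring

theorem isGraphGeodetic (h : G.IsPerronPair r p) (hG : G.Connected) :
    G.IsGraphGeodetic (G.perronDist r p) := fun i j k => by
  rw [Walk.forall_isPath_mem_support_iff, ← h.potential_eq_iff hG i j k, ← sub_eq_zero,
    perronDist_add_sub]
  have : (Fintype.card V : ℝ)⁻¹ * 2 ≠ 0 := by simp
  rw [mul_eq_zero_iff_left this, sub_eq_zero]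

theorem isDistance (h : G.IsPerronPair r p) (hG : G.Connected) :
    IsDistance (G.perronDist r p) := by
  have hself : ∀ i, G.perronDist r p i i = 0 := fun i => by
    rw [perronDist]; ring
  have hsymm : ∀ i j, G.perronDist r p i j = G.perronDist r p j i := fun i j => by
    rw [perronDist, perronDist, h.perronKernel_comm hG i j]; ring
  have htri : ∀ i j k, G.perronDist r p i k ≤ G.perronDist r p i j + G.perronDist r p j k :=
    fun i j k => by
      rw [← sub_nonneg, perronDist_add_sub]
      exact mul_nonneg (by positivity) (sub_nonneg.2 (h.potential_le hG k j i))
  refine ⟨fun i j => ?_, fun i j => ⟨fun hij => ?_, ?_⟩, hsymm, htri⟩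
  · have := htri i j i
    rw [hself, hsymm j i] at this
    linarith
  -- If d(i,j) = 0, then d(i,j) + d(j,i) = d(i,i), so the trivial path at i must contain j.
  · have h1 := (h.isGraphGeodetic hG i j i).1 (by rw [hself, hsymm j i, hij, add_zero]) Walk.nil
      (by simp [Walk.IsPath, Walk.support])
    rw [Walk.support, List.mem_singleton] at h1
    exact h1.symm
  · rintro rfl
    exact hself i

open scoped MatrixOrder Matrix.Norms.L2Operator in
-- Factor the inverse Perron matrix as `star B * B`. The columns of B, scaled by 1/(p_i √n), have
-- Gram matrix K/n, and expanding the squared distance gives the formula for d.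
theorem isSquaredEuclidean (h : G.IsPerronPair r p) (hG : G.Connected) :
    IsSquaredEuclidean (G.perronDist r p) := by
  obtain ⟨B, hB⟩ := CStarAlgebra.nonneg_iff_eq_star_mul_self.1 (h.posDef hG).inv.posSemidef.nonneg
  let e := Fintype.equivFin V
  obtain ⟨s, hn, hn0⟩ : ∃ s : ℝ, (Fintype.card V : ℝ) = s * s ∧ s ≠ 0 :=
    ⟨√(Fintype.card V), (Real.mul_self_sqrt (by positivity)).symm, by simp⟩
  refine ⟨Fintype.card V, fun i => WithLp.toLp 2 fun a =>
    B (e.symm a) i / (p i * s), fun i j => ?_⟩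
  have hK : ∀ i j, (Fintype.card V : ℝ)⁻¹ * G.perronKernel r p i j =
      ∑ a, B a i / (p i * s) * (B a j / (p j * s)) := fun i j => by
    have hi := (h.pos i).ne'
    have hj := (h.pos j).ne'
    rw [perronKernel, hB, mul_apply, Finset.sum_div, Finset.mul_sum, hn]
    refine Finset.sum_congr rfl fun a _ => ?_
    rw [star_apply, star_trivial]
    field_simp
  rw [EuclideanSpace.dist_eq, Real.sq_sqrt (Finset.sum_nonneg fun _ _ => sq_nonneg _),
    e.symm.sum_comp (fun a => dist (B a i / (p i * s))
      (B a j / (p j * s)) ^ 2)]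
  calc G.perronDist r p i j = (Fintype.card V : ℝ)⁻¹ * G.perronKernel r p i i +
        (Fintype.card V : ℝ)⁻¹ * G.perronKernel r p j j -
        2 * ((Fintype.card V : ℝ)⁻¹ * G.perronKernel r p i j) := by rw [perronDist]; ring
    _ = _ := by
      rw [hK, hK, hK, Finset.mul_sum, ← Finset.sum_add_distrib, ← Finset.sum_sub_distrib]
      refine Finset.sum_congr rfl fun a _ => ?_
      rw [Real.dist_eq, sq_abs]
      ring

end IsPerronPair

end WeightedMultigraph

theorem mainTheorem10 {V : Type*} {E : Type*} [Fintype V] [DecidableEq V] [Nontrivial V]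
    [Fintype E] (G : WeightedMultigraph V E) (hG : G.Connected) :
    (∀ α : ℝ, 0 < α → G.WalkWeightsFinite (G.tParam α)) ∧
    (∀ i j : V, Tendsto (fun α : ℝ => G.scaledWalkDist α i j) atTop (𝓝 (G.longWalkDist i j))) ∧
    IsDistance G.longWalkDist ∧
    G.IsGraphGeodetic G.longWalkDist ∧
    IsSquaredEuclidean G.longWalkDist := by
  obtain ⟨r, p, h1, h2, h3, h4, h5⟩ := hG.exists_perronVector
  have h : G.IsPerronPair r p := ⟨h1, h2, h3, h4, h5⟩
  have hd : G.longWalkDist = G.perronDist r p := by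
    funext i j
    exact (h.tendsto_scaledWalkDist hG i j).limUnder_eq
  rw [hd]
  exact ⟨fun α hα => h.walkWeightsFinite hα, h.tendsto_scaledWalkDist hG, h.isDistance hG,
    h.isGraphGeodetic hG, h.isSquaredEuclidean hG⟩
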